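/- A $C^*$-algebra is called elementary if it is $*$-isomorphic to the algebra $K(H)$ of all compact operators on some complex Hilbert space $H \neq \{0\}$. Let $\mathcal J$ be the dual algebra constituted by a family $(\mathcal J_t)_{t\in T}$ of elementary ideals. That is, $\mathcal J$ is a $C^*$-algebra, the $\mathcal J_t$ are pairwise distinct closed ideals of $\mathcal J$, each $\mathcal J_t$ is an elementary algebra, and $\mathcal J$ is the smallest closed ideal of $\mathcal J$ which contains all $\mathcal J_t$. For each $t \in T$, let $W_t : \mathcal J \to L(H_t)$ be an irreducible representation of $\mathcal J$ on a complex Hilbert space $H_t$ which lifts $\mathcal J_t$, i.e., whose restriction to $\mathcal J_t$ is injective. A family $(V_t)_{t\in T}$ of unital $*$-homomorphisms from a unital $C^*$-algebra $\mathcal A$ into unital $C^*$-algebras $\mathcal B_t$ is called spectral for $\mathcal A$ if an element $a \in \mathcal A$ is invertible if and only if all $V_t(a)$ are invertible and $\sup_{t\in T} \|V_t(a)^{-1}\| < \infty$; it is called strictly spectral for $\mathcal A$ if an element $a \in \mathcal A$ is invertible if and only if all $V_t(a)$ are invertible. Then the following hold. (a) The algebra $\mathcal J$ is unital if and only if $T$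 is finite and each algebra $\mathcal J_t$ is finite dimensional. In this case the $W_t$ are unital, and $(W_t)_{t\in T}$ is a strictly spectral family for $\mathcal J$. (b) Suppose $\mathcal J$ is not unital, let $\mathcal A = \mathbb C e + \mathcal J$ be its minimal unitization, and extend each $W_t$ to $\mathcal A$ by $W_t(\gamma e + j) = \gamma I + W_t(j)$. Then $(W_t)_{t\in T}$ is a spectral family for $\mathcal A$, and it is strictly spectral for $\mathcal A$ if at least one of the algebras $\mathcal J_t$ is infinite dimensional. -/

import Mathlib

universe u v w x

/-- `e` is a (two-sided) identity element of `A`. -/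
def IsIdentity {A : Type*} [Mul A] (e : A) : Prop :=
  ∀ a : A, e * a = a ∧ a * e = a

/-- The algebra `A` is unital: it has an identity element. -/
def IsUnitalAlgebra (A : Type*) [Mul A] : Prop :=
  ∃ e : A, IsIdentity e

/-- `a` is invertible with respect to the identity element `e`. -/
def IsInvertibleIn {A : Type*} [Mul A] (e a : A) : Prop :=
  ∃ b : A, a * b = e ∧ b * a = e

/-- `A` is an elementary algebra: `*`-isomorphic to the algebra `K(K)` of the compact operators on
some Hilbert space `K ≠ {0}`, the isomorphism being written as an injective `*`-homomorphism into
the bounded operators on `K` whose range is the set of the compact operators. -/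
def IsElementaryAlgebra (A : Type u) [NonUnitalNonAssocSemiring A] [Module ℂ A]
    [Star A] : Prop :=
  ∃ (K : Type w) (_ : NormedAddCommGroup K) (_ : InnerProductSpace ℂ K) (_ : CompleteSpace K)
    (φ : A →⋆ₙₐ[ℂ] (K →L[ℂ] K)),
    Nontrivial K ∧ Function.Injective φ ∧ Set.range φ = {S : K →L[ℂ] K | IsCompactOperator S}

/-- `I` is a closed (two-sided) ideal of the C*-algebra `A`. (Closed ideals of a C*-algebra are
automatically self-adjoint linear subspaces, so `I` is given as a `*`-subalgebra; this also makes
it an algebra of its own.) -/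
structure IsClosedIdeal {A : Type*} [NonUnitalCStarAlgebra A]
    (I : NonUnitalStarSubalgebra ℂ A) : Prop where
  isClosed : IsClosed (I : Set A)
  mul_mem_left : ∀ a : A, ∀ x ∈ I, a * x ∈ I
  mul_mem_right : ∀ a : A, ∀ x ∈ I, x * a ∈ I

/-- `J` is the dual algebra constituted by the family `(Jt t)` of elementary ideals: the `Jt t` are
pairwise distinct closed ideals of `J`, each of them is an elementary algebra, and `J` is the
smallest closed ideal of `J` which contains all of them. -/
structure IsDualAlgebraOf {J : Type u} [NonUnitalCStarAlgebra J] {T : Type v}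
    (Jt : T → NonUnitalStarSubalgebra ℂ J) : Prop where
  isClosedIdeal : ∀ t, IsClosedIdeal (Jt t)
  isElementary : ∀ t, IsElementaryAlgebra.{u, w} (Jt t)
  injective : Function.Injective Jt
  generates : ∀ I : NonUnitalStarSubalgebra ℂ J, IsClosedIdeal I → (∀ t, Jt t ≤ I) → I = ⊤

/-- `π` is an irreducible representation of the C*-algebra `A` on the Hilbert space `H`: it is
non-zero, and `{0}` and `H` are the only closed invariant subspaces. -/
structure IsIrreducibleRep {A : Type*} [NonUnitalCStarAlgebra A] {H : Type*}
    [NormedAddCommGroup H] [InnerProductSpace ℂ H] [CompleteSpace H]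
    (π : A →⋆ₙₐ[ℂ] (H →L[ℂ] H)) : Prop where
  ne_zero : ∃ a, π a ≠ 0
  eq_bot_or_eq_top : ∀ M : Submodule ℂ H, IsClosed (M : Set H) →
    (∀ a : A, ∀ x ∈ M, π a x ∈ M) → M = ⊥ ∨ M = ⊤

/-- A homomorphism lifts the ideal `I` if its restriction to `I` is injective. -/
def LiftsIdeal {A B : Type*} [NonUnitalCStarAlgebra A] [NonUnitalCStarAlgebra B]
    (π : A →⋆ₙₐ[ℂ] B) (I : NonUnitalStarSubalgebra ℂ A) : Prop :=
  Set.InjOn π (I : Set A)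

/-- `(W t)` is a spectral family for the C*-algebra `A` with identity element `e`: the
homomorphisms `W t` are unital, and `a ∈ A` is invertible if and only if all elements `W t a` are
invertible and the norms of their inverses are bounded uniformly with respect to `t`. -/
structure IsSpectralFamily {A : Type*} [NonUnitalCStarAlgebra A] (e : A) {T : Type*}
    {B : T → Type*} [∀ t, CStarAlgebra (B t)] (W : ∀ t, A →⋆ₙₐ[ℂ] B t) : Prop where
  isIdentity : IsIdentity e
  map_identity : ∀ t, W t e = 1
  isInvertibleIn_iff : ∀ a : A, IsInvertibleIn e a ↔
    (∀ t, IsUnit (W t a)) ∧ ∃ M : ℝ, ∀ t, ‖Ring.inverse (W t a)‖ ≤ M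

/-- `(W t)` is a strictly spectral family for the C*-algebra `A` with identity element `e`: the
homomorphisms `W t` are unital, and `a ∈ A` is invertible if and only if every `W t a` is. -/
structure IsStrictlySpectralFamily {A : Type*} [NonUnitalCStarAlgebra A] (e : A) {T : Type*}
    {B : T → Type*} [∀ t, CStarAlgebra (B t)] (W : ∀ t, A →⋆ₙₐ[ℂ] B t) : Prop where
  isIdentity : IsIdentity e
  map_identity : ∀ t, W t e = 1
  isInvertibleIn_iff : ∀ a : A, IsInvertibleIn e a ↔ ∀ t, IsUnit (W t a)

/-- The extension `γ e + j ↦ γ I + π j` of a representation `π` of `J` to the minimal unitization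
`ℂ e + J` of `J`. -/
noncomputable def unitizationRep {J : Type*} [NonUnitalCStarAlgebra J] {H : Type*}
    [NormedAddCommGroup H] [InnerProductSpace ℂ H] [CompleteSpace H]
    (π : J →⋆ₙₐ[ℂ] (H →L[ℂ] H)) : Unitization ℂ J →⋆ₙₐ[ℂ] (H →L[ℂ] H) :=
  (Unitization.starLift π).toNonUnitalStarAlgHom

theorem unitizationRep_apply {J : Type*} [NonUnitalCStarAlgebra J] {H : Type*}
    [NormedAddCommGroup H] [InnerProductSpace ℂ H] [CompleteSpace H]
    (π : J →⋆ₙₐ[ℂ] (H →L[ℂ] H)) (a : Unitization ℂ J) :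
    unitizationRep π a = a.fst • (1 : H →L[ℂ] H) + π a.snd := by
  show Unitization.starLift π a = _
  simp [Unitization.starLift, Algebra.algebraMap_eq_smul_one]

/-! Joint injectivity gives spectrality: the direct sum of the representations embeds the algebra
isometrically in the bounded families, where invertibility means invertible components with bounded
inverses, and inverses stay in the closed image (`isSpectralFamily_of_jointly_injective`).

Elementary algebras are topologically simple, so distinct ideals `Jt s`, `Jt t` annihilate each
other. Hence `W t` kills every other `Jt s`, and generation by the ideals yields three facts: `W t`
maps `J` into the image of `Jt t`, the `W t` are jointly injective, and `‖W t j‖` vanishes at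
infinity over `T`.

For (a), a unit has images of norm one, so `T` is finite; each image lies in that of `Jt t`, so `Jt
t` is unital, hence finite-dimensional. For (b), a nonzero scalar part dominates `W t j` for all but
finitely many `t`, which bounds the inverses; an infinite-dimensional `Jt t` excludes scalar part
zero. -/

/-! ### Spectral permanence and direct sums of representations. -/

section SpectralPermanence

open scoped ENNReal

/-- An element of a closed star subalgebra `R` (possibly without unit) that is invertible in the
ambient unital C*-algebra has its inverse in `R`. -/
theorem NonUnitalStarSubalgebra.inverse_mem_of_isClosed {B : Type*} [CStarAlgebra B]
    (R : NonUnitalStarSubalgebra ℂ B) (hR : IsClosed (R : Set B)) {x : B} (hx : x ∈ R)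
    (hu : IsUnit x) : Ring.inverse x ∈ R := by
  -- The multipliers of `R` form a closed unital star subalgebra containing `R`, so unital spectral
  -- permanence applies there.
  let S : StarSubalgebra ℂ B :=
    { carrier := {s | ∀ r ∈ R, s * r ∈ R ∧ r * s ∈ R}
      mul_mem' := fun {a b} ha hb r hr => by
        rw [mul_assoc, ← mul_assoc r]
        exact ⟨(ha _ (hb r hr).1).1, (hb _ (ha r hr).2).2⟩
      add_mem' := fun {a b} ha hb r hr => by
        rw [add_mul, mul_add]
        exact ⟨add_mem (ha r hr).1 (hb r hr).1, add_mem (ha r hr).2 (hb r hr).2⟩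
      algebraMap_mem' := fun c r hr => by
        rw [← Algebra.commutes, ← Algebra.smul_def]
        exact ⟨SMulMemClass.smul_mem c hr, SMulMemClass.smul_mem c hr⟩
      star_mem' := fun {a} ha r hr => by
        have h := ha (star r) (star_mem hr)
        exact ⟨by simpa using star_mem h.2, by simpa using star_mem h.1⟩ }
  have hS : IsClosed (S : Set B) := by
    have : (S : Set B) = ⋂ r ∈ R, ((fun s => s * r) ⁻¹' (R : Set B) ∩ (fun s => r * s) ⁻¹' R) := by
      ext s
      simp only [Set.mem_iInter]
      rfl
    rw [this]
    exact isClosed_biInter fun r _ =>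
      (hR.preimage (by fun_prop)).inter (hR.preimage (by fun_prop))
  have hxS : x ∈ S := fun r hr => ⟨mul_mem hx hr, mul_mem hr hx⟩
  have hu' : IsUnit (⟨x, hxS⟩ : S) := (StarSubalgebra.coe_isUnit S).1 hu
  obtain ⟨y, hy⟩ := hu'.exists_left_inv
  have hy' : (y : B) * x = 1 := congrArg Subtype.val hy
  have hyx : (y : B) = Ring.inverse x := by
    rw [← mul_one (y : B), ← Ring.mul_inverse_cancel x hu, ← mul_assoc, hy', one_mul]
  -- Write `y = y * (y * x)`: the multiplier `y` sends `x`, and then `y * x`, into `R`.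
  rw [← hyx, ← mul_one (y : B), ← hy']
  exact (y.2 _ (y.2 x hx).1).1

/-- Spectral permanence for an injective homomorphism mapping `e` to the unit. -/
theorem isInvertibleIn_of_injective {A B : Type*} [NonUnitalCStarAlgebra A] [CStarAlgebra B]
    (Φ : A →⋆ₙₐ[ℂ] B) (hΦ : Function.Injective Φ) {e : A} (he : Φ e = 1) {a : A}
    (ha : IsUnit (Φ a)) : IsInvertibleIn e a := by
  have hcl : IsClosed (NonUnitalStarAlgHom.range Φ : Set B) := by
    have h := (NonUnitalStarAlgHom.isometry Φ hΦ).isClosedEmbedding.isClosed_range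
    exact h
  obtain ⟨b, hb⟩ := NonUnitalStarSubalgebra.inverse_mem_of_isClosed _ hcl
    (NonUnitalStarAlgHom.mem_range_self Φ a) ha
  have hb' : Φ b = Ring.inverse (Φ a) := hb
  refine ⟨b, hΦ ?_, hΦ ?_⟩
  · rw [map_mul, hb', he, Ring.mul_inverse_cancel _ ha]
  · rw [map_mul, hb', he, Ring.inverse_mul_cancel _ ha]

theorem NonUnitalStarAlgHom.continuous_of_cstar {A B : Type*} [NonUnitalCStarAlgebra A]
    [NonUnitalCStarAlgebra B] (π : A →⋆ₙₐ[ℂ] B) : Continuous π :=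
  AddMonoidHomClass.continuous_of_bound π 1 fun a => by
    simpa using NonUnitalStarAlgHom.norm_apply_le π a

noncomputable instance lp.instCStarAlgebraInfty {T : Type*} {B : T → Type*}
    [∀ t, CStarAlgebra (B t)] [∀ t, NormOneClass (B t)] : CStarAlgebra (lp B ∞) :=
  { lp.inftyNormedRing, lp.inftyStarRing, lp.inftyCStarRing, lp.inftyNormedAlgebra (𝕜 := ℂ),
    (inferInstance : CompleteSpace (lp B ∞)), (inferInstance : StarModule ℂ (lp B ∞)) with }

/-- The direct sum of a family of `*`-homomorphisms. -/
noncomputable def lpInftyLift {A : Type*} [NonUnitalCStarAlgebra A] {T : Type*} {B : T → Type*}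
    [∀ t, CStarAlgebra (B t)] [∀ t, NormOneClass (B t)] (W : ∀ t, A →⋆ₙₐ[ℂ] B t) :
    A →⋆ₙₐ[ℂ] lp B ∞ where
  toFun a := ⟨fun t => W t a, memℓp_infty ⟨‖a‖, by
    rintro _ ⟨t, rfl⟩
    exact NonUnitalStarAlgHom.norm_apply_le (W t) a⟩⟩
  map_smul' c a := by ext t; exact map_smul (W t) c a
  map_zero' := by ext t; exact map_zero (W t)
  map_add' a b := by ext t; exact map_add (W t) a b
  map_mul' a b := by ext t; exact map_mul (W t) a b
  map_star' a := by ext t; exact map_star (W t) a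

/-- A jointly injective family of unital homomorphisms is spectral. -/
theorem isSpectralFamily_of_jointly_injective {A : Type*} [NonUnitalCStarAlgebra A] {e : A}
    {T : Type*} {B : T → Type*} [∀ t, CStarAlgebra (B t)] [∀ t, NormOneClass (B t)]
    (W : ∀ t, A →⋆ₙₐ[ℂ] B t) (hW : ∀ a, (∀ t, W t a = 0) → a = 0) (he : ∀ t, W t e = 1) :
    IsSpectralFamily e W where
  isIdentity a := by
    constructor <;> rw [← sub_eq_zero] <;> exact hW _ fun t => by simp [he]
  map_identity := he
  isInvertibleIn_iff a := by
    constructor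
    · rintro ⟨b, hab, hba⟩
      have hab' t : W t a * W t b = 1 := by rw [← map_mul, hab, he]
      have hba' t : W t b * W t a = 1 := by rw [← map_mul, hba, he]
      have hu t : IsUnit (W t a) := ⟨⟨_, _, hab' t, hba' t⟩, rfl⟩
      refine ⟨hu, ‖b‖, fun t => ?_⟩
      have : Ring.inverse (W t a) = W t b :=
        Ring.inverse_unit ⟨_, _, hab' t, hba' t⟩
      rw [this]
      exact NonUnitalStarAlgHom.norm_apply_le (W t) b
    · rintro ⟨hu, M, hM⟩
      have hinj : Function.Injective (lpInftyLift W) := by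
        rw [injective_iff_map_eq_zero]
        intro a ha
        exact hW a fun t => congrArg (fun f : lp B ∞ => f t) ha
      refine isInvertibleIn_of_injective (lpInftyLift W) hinj (e := e) ?_ ?_
      · ext t
        exact he t
      · let g : lp B ∞ := ⟨fun t => Ring.inverse (W t a), memℓp_infty ⟨M, by
          rintro _ ⟨t, rfl⟩
          exact hM t⟩⟩
        refine ⟨⟨lpInftyLift W a, g, ?_, ?_⟩, rfl⟩
        · ext t
          exact Ring.mul_inverse_cancel _ (hu t)
        · ext t
          exact Ring.inverse_mul_cancel _ (hu t)

end SpectralPermanence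

/-! ### Compact operators and elementary algebras. -/

open InnerProductSpace in
theorem isCompactOperator_rankOne {K : Type*} [NormedAddCommGroup K] [InnerProductSpace ℂ K]
    (p q : K) : IsCompactOperator (rankOne ℂ p q : K →L[ℂ] K) := by
  have h : IsCompactOperator (innerSL ℂ q : K → ℂ) :=
    isCompactOperator_of_locallyCompactSpace_dom (innerSL ℂ q)
  exact h.clm_comp (ContinuousLinearMap.toSpanSingleton ℂ p)

/-- A compact operator is approximated by its compressions to finite-dimensional ranges. -/
theorem IsCompactOperator.exists_norm_sub_starProjection_comp_le {K : Type*}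
    [NormedAddCommGroup K] [InnerProductSpace ℂ K] {S : K →L[ℂ] K} (hS : IsCompactOperator S)
    {ε : ℝ} (hε : 0 < ε) :
    ∃ (U : Submodule ℂ K) (_ : FiniteDimensional ℂ U), ‖S - U.starProjection * S‖ ≤ ε := by
  have hc : IsCompact (closure (S '' Metric.closedBall 0 1)) :=
    IsCompactOperator.isCompact_closure_image_closedBall (f := (S : K →ₗ[ℂ] K)) hS 1
  obtain ⟨F, hF, hcov⟩ := Metric.totallyBounded_iff.1 hc.totallyBounded ε hε
  have : Finite F := hF
  refine ⟨Submodule.span ℂ F, FiniteDimensional.span_of_finite ℂ hF, ?_⟩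
  have : FiniteDimensional ℂ (Submodule.span ℂ F) := FiniteDimensional.span_of_finite ℂ hF
  refine ContinuousLinearMap.opNorm_le_of_unit_norm hε.le fun y hy => ?_
  have hmem : S y ∈ closure (S '' Metric.closedBall 0 1) :=
    subset_closure ⟨y, by simp [hy], rfl⟩
  obtain ⟨z, hz, hyz⟩ := Set.mem_iUnion₂.1 (hcov hmem)
  -- The orthogonal projection approximates at least as well as the point `z` of the finite `ε`-net
  -- `F`.
  have h1 : ‖S y - (Submodule.span ℂ F).starProjection (S y)‖ ≤ ‖S y - z‖ := by
    rw [Submodule.starProjection_minimal]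
    exact ciInf_le ⟨0, by rintro _ ⟨_, rfl⟩; positivity⟩
      (⟨z, Submodule.subset_span hz⟩ : Submodule.span ℂ F)
  rw [mem_ball_iff_norm] at hyz
  exact h1.trans hyz.le

open InnerProductSpace in
theorem Submodule.starProjection_eq_sum_rankOne_of_finiteDimensional {K : Type*}
    [NormedAddCommGroup K] [InnerProductSpace ℂ K] (U : Submodule ℂ K) [FiniteDimensional ℂ U] :
    ∃ (n : ℕ) (b : Fin n → K), U.starProjection = ∑ i, rankOne ℂ (b i) (b i) := by
  refine ⟨_, fun i => (stdOrthonormalBasis ℂ U i : K), ?_⟩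
  exact (stdOrthonormalBasis ℂ U).starProjection_eq_sum_rankOne

open InnerProductSpace in
/-- Elementary algebras are topologically simple. -/
theorem IsElementaryAlgebra.eq_top_of_isClosedIdeal {A : Type u} [NonUnitalCStarAlgebra A]
    (hA : IsElementaryAlgebra.{u, w} A) {I : NonUnitalStarSubalgebra ℂ A} (hI : IsClosedIdeal I)
    {y : A} (hy : y ∈ I) (hy0 : y ≠ 0) : I = ⊤ := by
  obtain ⟨K, _, _, _, φ, hK, hφ, hr⟩ := hA
  have hiso := NonUnitalStarAlgHom.norm_map φ hφ
  have hex {S : K →L[ℂ] K} (hS : IsCompactOperator S) : ∃ a, φ a = S := by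
    have : S ∈ Set.range φ := by rw [hr]; exact hS
    exact this
  have hφy : φ y ≠ 0 := fun h => hy0 (hφ (by rw [h, map_zero]))
  obtain ⟨k, hk⟩ : ∃ k, φ y k ≠ 0 := by
    by_contra! h
    exact hφy (ContinuousLinearMap.ext h)
  -- Sandwiching `φ y` between `rankOne ℂ p (φ y k)` and `rankOne ℂ k q` gives `‖φ y k‖²` times
  -- `rankOne ℂ p q`.
  have hone (p q : K) : ∃ a ∈ I, φ a = rankOne ℂ p q := by
    obtain ⟨b, hb⟩ := hex (isCompactOperator_rankOne p (φ y k))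
    obtain ⟨c, hc⟩ := hex (isCompactOperator_rankOne k q)
    refine ⟨((inner ℂ (φ y k) (φ y k) : ℂ)⁻¹) • (b * y * c),
      SMulMemClass.smul_mem _ (hI.mul_mem_right _ _ (hI.mul_mem_left _ _ hy)), ?_⟩
    have h0 : (inner ℂ (φ y k) (φ y k) : ℂ) ≠ 0 := inner_self_ne_zero.2 hk
    rw [map_smul, map_mul, map_mul, hb, hc]
    ext z
    change (inner ℂ (φ y k) (φ y k) : ℂ)⁻¹ • rankOne ℂ p (φ y k) (φ y (rankOne ℂ k q z)) =
      rankOne ℂ p q z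
    simp only [rankOne_apply, map_smul, smul_smul]
    congr 1
    field_simp
  rw [eq_top_iff]
  rintro a -
  have hac : IsCompactOperator (φ a) := by
    have : φ a ∈ Set.range φ := ⟨a, rfl⟩
    rwa [hr] at this
  change a ∈ (I : Set A)
  rw [← hI.isClosed.closure_eq, Metric.mem_closure_iff]
  intro ε hε
  obtain ⟨U, hU, hle⟩ := hac.exists_norm_sub_starProjection_comp_le (half_pos hε)
  obtain ⟨n, b, hb⟩ := U.starProjection_eq_sum_rankOne_of_finiteDimensional
  choose c hcI hc using fun i => hone (b i) (b i)
  refine ⟨(∑ i, c i) * a, hI.mul_mem_right _ _ (sum_mem fun i _ => hcI i), ?_⟩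
  rw [dist_eq_norm, ← hiso, map_sub, map_mul, map_sum]
  simp only [hc]
  rw [← hb]
  linarith

open InnerProductSpace in
theorem IsElementaryAlgebra.exists_ne_zero {A : Type u} [NonUnitalCStarAlgebra A]
    (hA : IsElementaryAlgebra.{u, w} A) : ∃ a : A, a ≠ 0 := by
  obtain ⟨K, _, _, _, φ, hK, hφ, hr⟩ := hA
  obtain ⟨k, hk⟩ := exists_ne (0 : K)
  have : rankOne ℂ k k ∈ Set.range φ := by rw [hr]; exact isCompactOperator_rankOne k k
  obtain ⟨a, ha⟩ := this
  refine ⟨a, ?_⟩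
  rintro rfl
  rw [map_zero] at ha
  exact rankOne_ne_zero hk hk ha.symm

open InnerProductSpace in
/-- An elementary algebra is unital if and only if it is finite-dimensional. -/
theorem IsElementaryAlgebra.isUnitalAlgebra_iff {A : Type u} [NonUnitalCStarAlgebra A]
    (hA : IsElementaryAlgebra.{u, w} A) : IsUnitalAlgebra A ↔ FiniteDimensional ℂ A := by
  obtain ⟨K, _, _, _, φ, hK, hφ, hr⟩ := hA
  let L : A →ₗ[ℂ] (K →L[ℂ] K) := (φ : A →ₗ[ℂ] (K →L[ℂ] K))
  constructor
  · rintro ⟨e, he⟩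
    have hone : φ e = 1 := by
      ext k
      have : rankOne ℂ k k ∈ Set.range φ := by rw [hr]; exact isCompactOperator_rankOne k k
      obtain ⟨a, ha⟩ := this
      have h := congrArg φ (he a).1
      rw [map_mul, ha] at h
      have h := congrArg (fun f : K →L[ℂ] K => f k) h
      by_cases hk : k = 0
      · simp [hk]
      · simpa [hk] using h
    have hc : IsCompactOperator (φ e) := by
      have : φ e ∈ Set.range φ := ⟨e, rfl⟩
      rwa [hr] at this
    rw [hone] at hc
    have : FiniteDimensional ℂ K := FiniteDimensional.of_isCompactOperator_id (𝕜 := ℂ) hc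
    have : FiniteDimensional ℂ (K →L[ℂ] K) :=
      (LinearMap.toContinuousLinearMap (𝕜 := ℂ) (E := K) (F' := K)).finiteDimensional
    exact FiniteDimensional.of_injective L hφ
  · intro hfin
    obtain ⟨k, hk⟩ := exists_ne (0 : K)
    have hex (p : K) : rankOne ℂ p k ∈ L.range := by
      have : rankOne ℂ p k ∈ Set.range φ := by rw [hr]; exact isCompactOperator_rankOne p k
      exact this
    -- The rank-one operators with `k` fixed embed `K` in the finite-dimensional range.
    let R : K →ₗ[ℂ] L.range :=
      { toFun := fun p => ⟨rankOne ℂ p k, hex p⟩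
        map_add' := fun p q => by ext; simp
        map_smul' := fun c p => by ext; simp }
    have hR : Function.Injective R := by
      intro p q hpq
      have h := congrArg (fun f : L.range => (f : K →L[ℂ] K) k) hpq
      simpa [R, hk] using h
    have : FiniteDimensional ℂ K := FiniteDimensional.of_injective R hR
    have h1 : (1 : K →L[ℂ] K) ∈ Set.range φ := by
      rw [hr]
      exact (isCompactOperator_id_iff_finiteDimensional (𝕜 := ℂ)).2 this
    obtain ⟨e, he⟩ := h1
    exact ⟨e, fun a => ⟨hφ (by rw [map_mul, he, one_mul]), hφ (by rw [map_mul, he, mul_one])⟩⟩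

/-! ### Irreducible representations and closed ideals. -/

section DualAlgebra

open Filter Topology

/-- A representation of a C*-algebra maps closed ideals on which it is injective onto closed
subalgebras. -/
theorem isClosed_image_of_liftsIdeal {A B : Type*} [NonUnitalCStarAlgebra A]
    [NonUnitalCStarAlgebra B] (π : A →⋆ₙₐ[ℂ] B) {I : NonUnitalStarSubalgebra ℂ A}
    (hI : IsClosedIdeal I) (hπ : LiftsIdeal π I) : IsClosed (π '' (I : Set A)) := by
  have : IsClosed (I : Set A) := hI.isClosed
  let ψ : I →⋆ₙₐ[ℂ] B := π.comp (NonUnitalStarSubalgebraClass.subtype I)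
  have hψ : Function.Injective ψ := fun x y hxy => Subtype.ext (hπ x.2 y.2 hxy)
  have h := (NonUnitalStarAlgHom.isometry ψ hψ).isClosedEmbedding.isClosed_range
  convert h using 1
  ext b
  simp [ψ]

/-- An irreducible representation that does not vanish on an ideal is non-degenerate there. -/
theorem IsIrreducibleRep.eq_zero_of_forall_mem {A : Type*} [NonUnitalCStarAlgebra A] {H : Type*}
    [NormedAddCommGroup H] [InnerProductSpace ℂ H] [CompleteSpace H]
    {π : A →⋆ₙₐ[ℂ] (H →L[ℂ] H)} (hπ : IsIrreducibleRep π) {I : NonUnitalStarSubalgebra ℂ A}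
    (hI : IsClosedIdeal I) (hne : ∃ z ∈ I, π z ≠ 0) {h : H} (hh : ∀ y ∈ I, π y h = 0) :
    h = 0 := by
  -- The common kernel of the ideal is invariant because `y * a ∈ I` for `y ∈ I`.
  let M : Submodule ℂ H := ⨅ y ∈ I, (π y).ker
  have hM (k : H) : k ∈ M ↔ ∀ y ∈ I, π y k = 0 := by simp [M]
  have hcl : IsClosed (M : Set H) := by
    have : (M : Set H) = ⋂ y ∈ I, (π y) ⁻¹' {0} := by
      ext k
      simp [hM]
    rw [this]
    exact isClosed_biInter fun y _ => isClosed_singleton.preimage (π y).continuous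
  rcases hπ.eq_bot_or_eq_top M hcl fun a k hk => (hM _).2 fun y hy => by
    have := (hM k).1 hk _ (hI.mul_mem_right a y hy)
    rwa [map_mul] at this with h0 | h1
  · have : h ∈ M := (hM h).2 hh
    rwa [h0, Submodule.mem_bot] at this
  · obtain ⟨z, hz, hz0⟩ := hne
    refine absurd (ContinuousLinearMap.ext fun k => ?_) hz0
    have : k ∈ M := h1 ▸ Submodule.mem_top
    exact (hM k).1 this z hz

/-- Needed for `NormOneClass` on the operators on `H`, which the direct sum and the norm estimates
use. -/
theorem IsIrreducibleRep.nontrivial {A : Type*} [NonUnitalCStarAlgebra A] {H : Type*}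
    [NormedAddCommGroup H] [InnerProductSpace ℂ H] [CompleteSpace H]
    {π : A →⋆ₙₐ[ℂ] (H →L[ℂ] H)} (hπ : IsIrreducibleRep π) : Nontrivial H := by
  obtain ⟨a, ha⟩ := hπ.ne_zero
  by_contra h
  rw [not_nontrivial_iff_subsingleton] at h
  exact ha (Subsingleton.elim _ _)

/-! ### Structure of dual algebras. -/

namespace IsDualAlgebraOf

variable {J : Type u} [NonUnitalCStarAlgebra J] {T : Type v} {Jt : T → NonUnitalStarSubalgebra ℂ J}

/-- The closure properties make `p` a closed ideal containing every `Jt t`, so minimality applies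
without describing elements of `J` as limits of sums. -/
theorem induction (hJ : IsDualAlgebraOf.{u, v, w} Jt) {p : J → Prop} (hcl : IsClosed {j | p j})
    (zero : p 0) (add : ∀ a b, p a → p b → p (a + b)) (smul : ∀ (c : ℂ) a, p a → p (c • a))
    (star_mem : ∀ a, p a → p (star a)) (mul_left : ∀ c a, p a → p (c * a))
    (mul_right : ∀ c a, p a → p (a * c)) (mem : ∀ t, ∀ a ∈ Jt t, p a) (j : J) : p j := by
  let I : NonUnitalStarSubalgebra ℂ J :=
    { carrier := {j | p j}
      zero_mem' := zero
      add_mem' := fun {a b} ha hb => add a b ha hb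
      smul_mem' := fun c a ha => smul c a ha
      star_mem' := fun {a} ha => star_mem a ha
      mul_mem' := fun {a b} _ hb => mul_left a b hb }
  have hI : I = ⊤ := hJ.generates I ⟨hcl, fun c a ha => mul_left c a ha,
    fun c a ha => mul_right c a ha⟩ fun t a ha => mem t a ha
  have : j ∈ I := hI ▸ trivial
  exact this

/-- The intersection is a nonzero closed ideal of the topologically simple algebra `Jt s`. -/
theorem le_of_mem_of_ne_zero (hJ : IsDualAlgebraOf.{u, v, w} Jt) {s t : T} {z : J}
    (hs : z ∈ Jt s) (ht : z ∈ Jt t) (hz : z ≠ 0) : Jt s ≤ Jt t := by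
  have hcs : IsClosed (Jt s : Set J) := (hJ.isClosedIdeal s).isClosed
  let I : NonUnitalStarSubalgebra ℂ (Jt s) :=
    (Jt t).comap (NonUnitalStarSubalgebraClass.subtype (Jt s))
  have hI : IsClosedIdeal I :=
    ⟨(hJ.isClosedIdeal t).isClosed.preimage continuous_subtype_val,
      fun a x hx => (hJ.isClosedIdeal t).mul_mem_left a x hx,
      fun a x hx => (hJ.isClosedIdeal t).mul_mem_right a x hx⟩
  have htop : I = ⊤ := (hJ.isElementary s).eq_top_of_isClosedIdeal hI (y := ⟨z, hs⟩) ht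
    fun h => hz (congrArg Subtype.val h)
  intro a ha
  have : (⟨a, ha⟩ : Jt s) ∈ I := htop ▸ trivial
  exact this

theorem mul_eq_zero_of_ne (hJ : IsDualAlgebraOf.{u, v, w} Jt) {s t : T} (hst : s ≠ t) {a b : J}
    (ha : a ∈ Jt s) (hb : b ∈ Jt t) : a * b = 0 := by
  by_contra h
  have h1 := (hJ.isClosedIdeal s).mul_mem_right b a ha
  have h2 := (hJ.isClosedIdeal t).mul_mem_left a b hb
  exact hst (hJ.injective
    (le_antisymm (hJ.le_of_mem_of_ne_zero h1 h2 h) (hJ.le_of_mem_of_ne_zero h2 h1 h)))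

variable {H : T → Type x} [∀ t, NormedAddCommGroup (H t)] [∀ t, InnerProductSpace ℂ (H t)]
  [∀ t, CompleteSpace (H t)] {W : ∀ t, J →⋆ₙₐ[ℂ] (H t →L[ℂ] H t)}

theorem exists_map_ne_zero (hJ : IsDualAlgebraOf.{u, v, w} Jt)
    (hlift : ∀ t, LiftsIdeal (W t) (Jt t)) (t : T) : ∃ z ∈ Jt t, W t z ≠ 0 := by
  have hc : IsClosed (Jt t : Set J) := (hJ.isClosedIdeal t).isClosed
  obtain ⟨z, hz⟩ := (hJ.isElementary t).exists_ne_zero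
  refine ⟨z, z.2, fun h => hz (Subtype.ext (hlift t z.2 (zero_mem _) ?_))⟩
  exact h.trans (map_zero (W t)).symm

/-- Since `Jt t` annihilates `a`, the range of `W t a` is killed by the image of `Jt t`, which acts
non-degenerately. -/
theorem map_eq_zero_of_ne (hJ : IsDualAlgebraOf.{u, v, w} Jt)
    (hW : ∀ t, IsIrreducibleRep (W t)) (hlift : ∀ t, LiftsIdeal (W t) (Jt t)) {s t : T}
    (hst : s ≠ t) {a : J} (ha : a ∈ Jt s) : W t a = 0 := by
  ext h
  refine (hW t).eq_zero_of_forall_mem (hJ.isClosedIdeal t) (hJ.exists_map_ne_zero hlift t)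
    fun y hy => ?_
  change (W t y * W t a) h = 0
  rw [← map_mul, hJ.mul_eq_zero_of_ne hst.symm hy ha, map_zero]
  rfl

theorem map_eq_one_of_forall_mul_eq (hJ : IsDualAlgebraOf.{u, v, w} Jt)
    (hW : ∀ t, IsIrreducibleRep (W t)) (hlift : ∀ t, LiftsIdeal (W t) (Jt t)) {t : T} {e : J}
    (he : ∀ y ∈ Jt t, y * e = y) : W t e = 1 := by
  ext h
  rw [← sub_eq_zero]
  refine (hW t).eq_zero_of_forall_mem (hJ.isClosedIdeal t) (hJ.exists_map_ne_zero hlift t)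
    fun y hy => ?_
  have : (W t y * W t e) h = W t y h := by rw [← map_mul, he y hy]
  rw [map_sub, sub_eq_zero]
  exact this

/-- The image of `Jt t` is closed, so its preimage is a closed ideal; it contains the other `Jt s`
because `W t` kills them. This stands in for compactness of `W t j`. -/
theorem exists_mem_map_eq (hJ : IsDualAlgebraOf.{u, v, w} Jt)
    (hW : ∀ t, IsIrreducibleRep (W t)) (hlift : ∀ t, LiftsIdeal (W t) (Jt t)) (t : T) (j : J) :
    ∃ a ∈ Jt t, W t a = W t j := by
  refine hJ.induction (p := fun j => ∃ a ∈ Jt t, W t a = W t j) ?_ ?_ ?_ ?_ ?_ ?_ ?_ ?_ j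
  · exact (isClosed_image_of_liftsIdeal (W t) (hJ.isClosedIdeal t) (hlift t)).preimage
      (W t).continuous_of_cstar
  · exact ⟨0, zero_mem _, rfl⟩
  · rintro a b ⟨a', ha, ha'⟩ ⟨b', hb, hb'⟩
    exact ⟨a' + b', add_mem ha hb, by rw [map_add, map_add, ha', hb']⟩
  · rintro c a ⟨a', ha, ha'⟩
    exact ⟨c • a', SMulMemClass.smul_mem c ha, by rw [map_smul, map_smul, ha']⟩
  · rintro a ⟨a', ha, ha'⟩
    exact ⟨star a', star_mem ha, by rw [map_star, map_star, ha']⟩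
  · rintro c a ⟨a', ha, ha'⟩
    exact ⟨c * a', (hJ.isClosedIdeal t).mul_mem_left c a' ha, by rw [map_mul, map_mul, ha']⟩
  · rintro c a ⟨a', ha, ha'⟩
    exact ⟨a' * c, (hJ.isClosedIdeal t).mul_mem_right c a' ha, by rw [map_mul, map_mul, ha']⟩
  · intro s a ha
    by_cases hst : s = t
    · subst hst
      exact ⟨a, ha, rfl⟩
    · exact ⟨0, zero_mem _, by rw [map_zero, hJ.map_eq_zero_of_ne hW hlift hst ha]⟩

/-- The images of the elements of a dual algebra are compact operators, so that they can be
invertible only in the finite-dimensional case. -/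
theorem finiteDimensional_of_isUnit_map (hJ : IsDualAlgebraOf.{u, v, w} Jt)
    (hW : ∀ t, IsIrreducibleRep (W t)) (hlift : ∀ t, LiftsIdeal (W t) (Jt t)) {t : T} {j : J}
    (hj : IsUnit (W t j)) : FiniteDimensional ℂ (Jt t) := by
  have hc : IsClosed (Jt t : Set J) := (hJ.isClosedIdeal t).isClosed
  refine (hJ.isElementary t).isUnitalAlgebra_iff.1 ?_
  obtain ⟨a, ha, haj⟩ := hJ.exists_mem_map_eq hW hlift t j
  have hmem : W t j ∈ (Jt t).map (W t) := ⟨a, ha, haj⟩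
  -- The inverse also comes from `Jt t`, so `1` has a preimage there, which injectivity makes an
  -- identity of `Jt t`.
  have hinv := NonUnitalStarSubalgebra.inverse_mem_of_isClosed ((Jt t).map (W t))
    (isClosed_image_of_liftsIdeal (W t) (hJ.isClosedIdeal t) (hlift t)) hmem hj
  obtain ⟨b, hb, hb'⟩ := hinv
  have hone : W t (a * b) = 1 := by
    rw [map_mul, haj]
    exact (congrArg (W t j * ·) hb').trans (Ring.mul_inverse_cancel _ hj)
  refine ⟨⟨a * b, mul_mem ha hb⟩, fun y => ⟨?_, ?_⟩⟩ <;> refine Subtype.ext ?_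
  · refine hlift t (mul_mem (mul_mem ha hb) y.2) y.2 ?_
    rw [map_mul, hone, one_mul]
  · refine hlift t (mul_mem y.2 (mul_mem ha hb)) y.2 ?_
    rw [map_mul, hone, mul_one]

theorem eq_zero_of_forall_map_eq_zero (hJ : IsDualAlgebraOf.{u, v, w} Jt)
    (hlift : ∀ t, LiftsIdeal (W t) (Jt t)) {n : J} (hn : ∀ t, W t n = 0) : n = 0 := by
  -- The annihilator of the joint kernel is a closed ideal. It contains `Jt t` because `a * m` and
  -- `m * a` lie in `Jt t`, where `W t` is injective. Taking `a = star n` then gives `n = 0`.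
  have key : ∀ a : J, ∀ m : J, (∀ t, W t m = 0) → a * m = 0 ∧ m * a = 0 := by
    refine hJ.induction ?_ ?_ ?_ ?_ ?_ ?_ ?_ ?_
    · simp only [Set.ofPred_forall, Set.ofPred_and]
      exact isClosed_iInter fun m => isClosed_iInter fun _ =>
        (isClosed_eq (by fun_prop) (by fun_prop)).inter (isClosed_eq (by fun_prop) (by fun_prop))
    · simp
    · intro a b ha hb m hm
      simp [add_mul, mul_add, ha m hm, hb m hm]
    · intro c a ha m hm
      simp [smul_mul_assoc, mul_smul_comm, ha m hm]
    · intro a ha m hm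
      have h := ha (star m) fun t => by rw [map_star, hm, star_zero]
      exact ⟨by simpa using congrArg star h.2, by simpa using congrArg star h.1⟩
    · intro c a ha m hm
      refine ⟨by rw [mul_assoc, (ha m hm).1, mul_zero], ?_⟩
      rw [← mul_assoc]
      exact (ha (m * c) fun t => by rw [map_mul, hm, zero_mul]).2
    · intro c a ha m hm
      refine ⟨?_, by rw [← mul_assoc, (ha m hm).2, zero_mul]⟩
      rw [mul_assoc]
      exact (ha (c * m) fun t => by rw [map_mul, hm, mul_zero]).1
    · intro t a ha m hm
      exact ⟨hlift t ((hJ.isClosedIdeal t).mul_mem_right m a ha) (zero_mem _)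
          (by rw [map_mul, hm, mul_zero, map_zero]),
        hlift t ((hJ.isClosedIdeal t).mul_mem_left m a ha) (zero_mem _)
          (by rw [map_mul, hm, zero_mul, map_zero])⟩
  exact CStarRing.star_mul_self_eq_zero_iff n |>.1 (key (star n) n hn).1

/-- The norms of the images of an element of a dual algebra vanish at infinity. -/
theorem tendsto_norm_map_cofinite (hJ : IsDualAlgebraOf.{u, v, w} Jt)
    (hW : ∀ t, IsIrreducibleRep (W t)) (hlift : ∀ t, LiftsIdeal (W t) (Jt t)) (j : J) :
    Tendsto (fun t => ‖W t j‖) cofinite (𝓝 0) := by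
  refine hJ.induction (p := fun j => Tendsto (fun t => ‖W t j‖) cofinite (𝓝 0))
    ?_ ?_ ?_ ?_ ?_ ?_ ?_ ?_ j
  · refine isClosed_of_closure_subset fun j hj => ?_
    change Tendsto _ _ _
    rw [Metric.tendsto_nhds]
    intro ε hε
    obtain ⟨i, hi, hij⟩ := Metric.mem_closure_iff.1 hj (ε / 2) (half_pos hε)
    filter_upwards [(Metric.tendsto_nhds.1 hi) (ε / 2) (half_pos hε)] with t ht
    rw [dist_zero_right, norm_norm] at ht ⊢
    have h1 : ‖W t (j - i)‖ ≤ ‖j - i‖ := NonUnitalStarAlgHom.norm_apply_le (W t) _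
    rw [dist_eq_norm] at hij
    have h2 : ‖W t j‖ ≤ ‖W t (j - i)‖ + ‖W t i‖ := by
      rw [map_sub]
      simpa using norm_add_le (W t j - W t i) (W t i)
    linarith
  · simpa using tendsto_const_nhds
  · intro a b ha hb
    refine squeeze_zero (fun t => norm_nonneg _) (fun t => ?_) (by simpa using ha.add hb)
    rw [map_add]
    exact norm_add_le _ _
  · intro c a ha
    refine squeeze_zero (fun t => norm_nonneg _) (fun t => ?_)
      (by simpa using ha.const_mul ‖c‖)
    rw [map_smul, norm_smul]
  · intro a ha
    simpa [map_star] using ha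
  · intro c a ha
    refine squeeze_zero (fun t => norm_nonneg _) (fun t => ?_)
      (by simpa using ha.const_mul ‖c‖)
    rw [map_mul]
    exact (norm_mul_le _ _).trans (mul_le_mul_of_nonneg_right
      (NonUnitalStarAlgHom.norm_apply_le (W t) c) (norm_nonneg _))
  · intro c a ha
    refine squeeze_zero (fun t => norm_nonneg _) (fun t => ?_)
      (by simpa using ha.mul_const ‖c‖)
    rw [map_mul]
    exact (norm_mul_le _ _).trans (mul_le_mul_of_nonneg_left
      (NonUnitalStarAlgHom.norm_apply_le (W t) c) (norm_nonneg _))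
  · intro s a ha
    refine tendsto_const_nhds.congr' ?_
    have : ({s}ᶜ : Set T) ∈ (cofinite : Filter T) := (Set.finite_singleton s).compl_mem_cofinite
    filter_upwards [this] with t ht
    rw [hJ.map_eq_zero_of_ne hW hlift (fun h => ht h.symm) ha, norm_zero]

/-! ### Units of dual algebras and the unital case. -/

theorem isIdentity_of_forall_map_eq_one (hJ : IsDualAlgebraOf.{u, v, w} Jt)
    (hlift : ∀ t, LiftsIdeal (W t) (Jt t)) {e : J} (he : ∀ t, W t e = 1) : IsIdentity e := by
  intro a
  constructor <;> rw [← sub_eq_zero] <;>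
    exact hJ.eq_zero_of_forall_map_eq_zero hlift fun t => by simp [he]

/-- The index set is finite if an element has images bounded away from zero. -/
theorem finite_of_forall_le_norm_map (hJ : IsDualAlgebraOf.{u, v, w} Jt)
    (hW : ∀ t, IsIrreducibleRep (W t)) (hlift : ∀ t, LiftsIdeal (W t) (Jt t)) {j : J} {δ : ℝ}
    (hδ : 0 < δ) (hj : ∀ t, δ ≤ ‖W t j‖) : Finite T := by
  have h := (hJ.tendsto_norm_map_cofinite hW hlift j).eventually_lt_const hδ
  rw [eventually_cofinite] at h
  refine Set.finite_univ_iff.1 (h.subset fun t _ => ?_)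
  exact not_lt.2 (hj t)

theorem isUnitalAlgebra_of_finite (hJ : IsDualAlgebraOf.{u, v, w} Jt)
    (hW : ∀ t, IsIrreducibleRep (W t)) (hlift : ∀ t, LiftsIdeal (W t) (Jt t)) [Finite T]
    (hfin : ∀ t, FiniteDimensional ℂ (Jt t)) : IsUnitalAlgebra J := by
  have := Fintype.ofFinite T
  have hex (t : T) : ∃ e ∈ Jt t, ∀ y ∈ Jt t, y * e = y := by
    have hc : IsClosed (Jt t : Set J) := (hJ.isClosedIdeal t).isClosed
    obtain ⟨e, he⟩ := (hJ.isElementary t).isUnitalAlgebra_iff.2 (hfin t)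
    exact ⟨e, e.2, fun y hy => congrArg Subtype.val (he ⟨y, hy⟩).2⟩
  choose e he hmul using hex
  refine ⟨∑ t, e t, hJ.isIdentity_of_forall_map_eq_one hlift fun t => ?_⟩
  rw [map_sum, Finset.sum_eq_single t (fun s _ hs => hJ.map_eq_zero_of_ne hW hlift hs (he s))
    fun h => absurd (Finset.mem_univ t) h]
  exact hJ.map_eq_one_of_forall_mul_eq hW hlift (hmul t)

theorem map_eq_one_of_isIdentity (hJ : IsDualAlgebraOf.{u, v, w} Jt)
    (hW : ∀ t, IsIrreducibleRep (W t)) (hlift : ∀ t, LiftsIdeal (W t) (Jt t)) {e : J}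
    (he : IsIdentity e) (t : T) : W t e = 1 :=
  hJ.map_eq_one_of_forall_mul_eq hW hlift fun y _ => (he y).2

theorem isUnitalAlgebra_iff (hJ : IsDualAlgebraOf.{u, v, w} Jt)
    (hW : ∀ t, IsIrreducibleRep (W t)) (hlift : ∀ t, LiftsIdeal (W t) (Jt t)) :
    IsUnitalAlgebra J ↔ Finite T ∧ ∀ t, FiniteDimensional ℂ (Jt t) := by
  constructor
  · rintro ⟨e, he⟩
    have hone := hJ.map_eq_one_of_isIdentity hW hlift he
    refine ⟨hJ.finite_of_forall_le_norm_map hW hlift one_pos (j := e) fun t => ?_, fun t =>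
      hJ.finiteDimensional_of_isUnit_map hW hlift (j := e) (by rw [hone]; exact isUnit_one)⟩
    have := (hW t).nontrivial
    rw [hone, norm_one]
  · rintro ⟨_, hfin⟩
    exact hJ.isUnitalAlgebra_of_finite hW hlift hfin

theorem isStrictlySpectralFamily (hJ : IsDualAlgebraOf.{u, v, w} Jt)
    (hW : ∀ t, IsIrreducibleRep (W t)) (hlift : ∀ t, LiftsIdeal (W t) (Jt t)) {e : J}
    (he : IsIdentity e) : IsStrictlySpectralFamily e W := by
  have (t : T) := (hW t).nontrivial
  have hone := hJ.map_eq_one_of_isIdentity hW hlift he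
  have hspec := isSpectralFamily_of_jointly_injective W
    (fun _ h => hJ.eq_zero_of_forall_map_eq_zero hlift h) hone
  have := ((hJ.isUnitalAlgebra_iff hW hlift).1 ⟨e, he⟩).1
  refine ⟨he, hone, fun a => ⟨fun h => ((hspec.isInvertibleIn_iff a).1 h).1, fun h =>
    (hspec.isInvertibleIn_iff a).2 ⟨h, ?_⟩⟩⟩
  obtain ⟨M, hM⟩ := (Set.finite_range fun t => ‖Ring.inverse (W t a)‖).bddAbove
  exact ⟨M, fun t => hM ⟨t, rfl⟩⟩

/-- Only joint injectivity is at stake: if all images of `γ e + j` vanish with `γ ≠ 0`, then `-γ⁻¹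
j` has all images `1` and would be an identity of `J`. -/
theorem isSpectralFamily_unitizationRep (hJ : IsDualAlgebraOf.{u, v, w} Jt)
    (hW : ∀ t, IsIrreducibleRep (W t)) (hlift : ∀ t, LiftsIdeal (W t) (Jt t))
    (hJ1 : ¬ IsUnitalAlgebra J) :
    IsSpectralFamily (1 : Unitization ℂ J) (fun t => unitizationRep (W t)) := by
  have (t : T) := (hW t).nontrivial
  refine isSpectralFamily_of_jointly_injective _ (fun a ha => ?_) fun t => ?_
  · simp only [unitizationRep_apply] at ha
    have hfst : a.fst = 0 := by
      by_contra hne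
      refine hJ1 ⟨-(a.fst)⁻¹ • a.snd, hJ.isIdentity_of_forall_map_eq_one hlift fun t => ?_⟩
      rw [map_smul, ← neg_eq_of_add_eq_zero_right (ha t), neg_smul, smul_neg, neg_neg, smul_smul,
        inv_mul_cancel₀ hne, one_smul]
    refine Unitization.ext hfst (hJ.eq_zero_of_forall_map_eq_zero hlift fun t => ?_)
    simpa [hfst] using ha t
  · rw [unitizationRep_apply]
    simp

end IsDualAlgebraOf

/-- With `c` the inverse, `γ c = 1 - b c`, and the term `b c` is absorbed because `b` has at most
half the size of `γ`. -/
theorem norm_inverse_smul_one_add_le {B : Type*} [CStarAlgebra B] [NormOneClass B] {γ : ℂ}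
    (hγ : γ ≠ 0) {b : B} (hb : ‖b‖ ≤ ‖γ‖ / 2) (hu : IsUnit (γ • 1 + b)) :
    ‖Ring.inverse (γ • 1 + b)‖ ≤ 2 / ‖γ‖ := by
  set c := Ring.inverse (γ • 1 + b)
  have h : γ • c = 1 - b * c := by
    rw [eq_sub_iff_add_eq, ← Ring.mul_inverse_cancel _ hu, add_mul, smul_mul_assoc, one_mul]
  have h1 : ‖γ‖ * ‖c‖ ≤ 1 + ‖γ‖ / 2 * ‖c‖ := by
    rw [← norm_smul, h]
    refine (norm_sub_le _ _).trans ?_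
    rw [norm_one]
    gcongr
    exact (norm_mul_le _ _).trans (by gcongr)
  rw [le_div_iff₀ (norm_pos_iff.2 hγ)]
  linarith

theorem IsDualAlgebraOf.isStrictlySpectralFamily_unitizationRep {J : Type u}
    [NonUnitalCStarAlgebra J] {T : Type v} {Jt : T → NonUnitalStarSubalgebra ℂ J}
    {H : T → Type x} [∀ t, NormedAddCommGroup (H t)] [∀ t, InnerProductSpace ℂ (H t)]
    [∀ t, CompleteSpace (H t)] {W : ∀ t, J →⋆ₙₐ[ℂ] (H t →L[ℂ] H t)}
    (hJ : IsDualAlgebraOf.{u, v, w} Jt)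
    (hW : ∀ t, IsIrreducibleRep (W t)) (hlift : ∀ t, LiftsIdeal (W t) (Jt t))
    (hJ1 : ¬ IsUnitalAlgebra J) (hinf : ∃ t, ¬ FiniteDimensional ℂ (Jt t)) :
    IsStrictlySpectralFamily (1 : Unitization ℂ J) (fun t => unitizationRep (W t)) := by
  have hspec := hJ.isSpectralFamily_unitizationRep hW hlift hJ1
  refine ⟨hspec.isIdentity, hspec.map_identity, fun a =>
    ⟨fun h => ((hspec.isInvertibleIn_iff a).1 h).1, fun h =>
      (hspec.isInvertibleIn_iff a).2 ⟨h, ?_⟩⟩⟩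
  obtain ⟨s, hs⟩ := hinf
  have hγ : a.fst ≠ 0 := by
    intro h0
    have hu := h s
    rw [unitizationRep_apply, h0, zero_smul, zero_add] at hu
    exact hs (hJ.finiteDimensional_of_isUnit_map hW hlift hu)
  -- Outside a finite set of indices `2 / ‖a.fst‖` bounds the inverses; finitely many exceptions do
  -- not affect boundedness.
  have hbdd : IsBoundedUnder (· ≤ ·) cofinite
      fun t => ‖Ring.inverse (unitizationRep (W t) a)‖ := by
    refine ⟨2 / ‖a.fst‖, eventually_map.2 ?_⟩
    filter_upwards [(hJ.tendsto_norm_map_cofinite hW hlift a.snd).eventually_lt_const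
      (half_pos (norm_pos_iff.2 hγ))] with t ht
    have := (hW t).nontrivial
    have hu := h t
    rw [unitizationRep_apply] at hu ⊢
    exact norm_inverse_smul_one_add_le hγ ht.le hu
  obtain ⟨M, hM⟩ := hbdd.bddAbove_range_of_cofinite
  exact ⟨M, fun t => hM ⟨t, rfl⟩⟩

end DualAlgebra

theorem mainTheorem12 {J : Type u} [NonUnitalCStarAlgebra J] {T : Type v}
    (Jt : T → NonUnitalStarSubalgebra ℂ J) (hJ : IsDualAlgebraOf.{u, v, w} Jt)
    (H : T → Type x) [∀ t, NormedAddCommGroup (H t)] [∀ t, InnerProductSpace ℂ (H t)]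
    [∀ t, CompleteSpace (H t)]
    (W : ∀ t, J →⋆ₙₐ[ℂ] (H t →L[ℂ] H t))
    (hW : ∀ t, IsIrreducibleRep (W t)) (hlift : ∀ t, LiftsIdeal (W t) (Jt t)) :
    (IsUnitalAlgebra J ↔ Finite T ∧ ∀ t, FiniteDimensional ℂ (Jt t)) ∧
    (∀ e : J, IsIdentity e → IsStrictlySpectralFamily e W) ∧
    (¬ IsUnitalAlgebra J →
      IsSpectralFamily (1 : Unitization ℂ J) (fun t => unitizationRep (W t)) ∧
      ((∃ t, ¬ FiniteDimensional ℂ (Jt t)) →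
        IsStrictlySpectralFamily (1 : Unitization ℂ J) (fun t => unitizationRep (W t)))) := by
  exact ⟨hJ.isUnitalAlgebra_iff hW hlift, fun _ he => hJ.isStrictlySpectralFamily hW hlift he,
    fun h => ⟨hJ.isSpectralFamily_unitizationRep hW hlift h,
      hJ.isStrictlySpectralFamily_unitizationRep hW hlift h⟩⟩
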